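/- Let $s\in[-1,1]$, $\Delta>0$ and $0<\epsilon\le 2\sqrt{2/(e\pi)}$. Put $$k=\frac{\sqrt2}{\Delta}\,\ln^{1/2}\!\Big(\frac{8}{\pi\epsilon^2}\Big),\qquad T=\max\Big\{\ln\Big(\frac{32k}{3\sqrt\pi\,\epsilon}\Big),\ \frac{4e^2}{\Delta^2}\ln\Big(\frac{8}{\pi\epsilon^2}\Big)\Big\},$$ $$n=\Big\lceil\sqrt{8\,\lceil T\rceil\,\ln\Big(\frac{64k}{3\sqrt\pi\,\epsilon}\Big)}+1\Big\rceil .$$ (The radicand can be negative only when $\Delta>4$, in which case the set in (1) is empty; the root is then read as $0$.) Then there is a real polynomial $p$, odd about $s$, i.e. $p(s-y)=-p(s+y)$ for all real $y$ (so $p$ is odd if $s=0$), whose degree is exactly $n$ if $n$ is odd and exactly $n-1$ if $n$ is even, such that $$|p(x)-\mathrm{sgn}(x-s)|\le\epsilon\qquad\text{for all }x\in[-1,\,s-\Delta/2]\cup[s+\Delta/2,\,1].\tag{1}$$ Moreover, if $\Delta\le 2$, the maximum $T$ equals its second entry $\frac{4e^2}{\Delta^2}\ln\big(\frac{8}{\pi\epsilon^2}\big)$,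 and hence $n=\Big\lceil\sqrt{8\,\big\lceil \frac{4e^2}{\Delta^2}\ln(\frac{8}{\pi\epsilon^2})\big\rceil\,\ln\big(\frac{64k}{3\sqrt\pi\,\epsilon}\big)}+1\Big\rceil$. -/

import Mathlib

/-- The scale `k = (√2 / Δ) ln^{1/2}(8 / (π ε²))`. -/
noncomputable def signScale (Δ ε : ℝ) : ℝ :=
  Real.sqrt 2 / Δ * Real.sqrt (Real.log (8 / (Real.pi * ε ^ 2)))

/-- The first entry of the maximum in the degree formula. -/
noncomputable def signTermLog (Δ ε : ℝ) : ℝ :=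
  Real.log (32 * signScale Δ ε / (3 * Real.sqrt Real.pi * ε))

/-- The second entry of the maximum in the degree formula. -/
noncomputable def signTermQuad (Δ ε : ℝ) : ℝ :=
  4 / Δ ^ 2 * Real.log (8 / (Real.pi * ε ^ 2)) * Real.exp 1 ^ 2

/-- `n = ⌈√(8 ⌈T⌉ ln(64 k / (3 √π ε))) + 1⌉`, as a function of the quantity `T`. -/
noncomputable def signDegreeOf (T Δ ε : ℝ) : ℕ :=
  ⌈Real.sqrt (8 * (⌈T⌉₊ : ℝ) *
      Real.log (64 * signScale Δ ε / (3 * Real.sqrt Real.pi * ε))) + 1⌉₊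

/-- The explicit number `n` bounding the degree. -/
noncomputable def signDegree (Δ ε : ℝ) : ℕ :=
  signDegreeOf (max (signTermLog Δ ε) (signTermQuad Δ ε)) Δ ε

/-! The sign is replaced by `erf (k (x - s))`, and `erf` by an odd polynomial. With `u = (x - s) /
2` and `λ = 2k²`, this `erf` is `4k/√π` times the integral from `0` to `u` of `exp (-2λv²) = exp
(-λ) * exp (-λw)`, where `w = 2v² - 1` lies in `[-1, 1]`. The exponential is cut at Taylor degree `t
= ⌈T⌉` (`abs_exp_sub_sum_le`). Each `w ^ j` is the mean of `T_{S_j}(w)` over a `±1` random walk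
`S_j`, so by Hoeffding (`sum_choose_filter_le`) indices above `d ~ √t` can be dropped. Since
`T_z(2v² - 1) = T_{2z}(v)`, integration leaves an odd polynomial of degree at most `2d + 1`, with `d
= (n - 1) / 2`. The errors are `ε/2` (Gaussian tail), `7ε/40` (Taylor) and `ε/4` (Chebyshev), in
total `37ε/40`. The slack pays for a small multiple of `(X - s) ^ (2d + 1)` that makes the degree
exact. -/

open Polynomial Finset

/-! ### Powers as random-walk averages of Chebyshev polynomials. -/

/-- A function on `ℤ` satisfying the recurrence of `cos` and `cosh`, multiplied by a power of the
step factor, is a binomial combination of its translates. -/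
theorem two_mul_pow_mul_eq_sum_choose {a : ℝ} {f : ℤ → ℝ}
    (hf : ∀ z, 2 * a * f z = f (z + 1) + f (z - 1)) (j : ℕ) (z : ℤ) :
    (2 * a) ^ j * f z = ∑ i ∈ range (j + 1), (j.choose i : ℝ) * f (z + (j - 2 * i)) := by
  induction j generalizing z with
  | zero => simp
  | succ j ih =>
    have h := sum_choose_succ_mul (R := ℝ)
      (fun i _ => f (z + (((j + 1 : ℕ) : ℤ) - 2 * i))) j
    rw [h, pow_succ, mul_assoc, hf, mul_add, ih, ih]
    congr 1 <;> refine sum_congr rfl fun i _ => ?_ <;> congr 2 <;> push_cast <;> ring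

theorem pow_eq_sum_choose_chebyshev (w : ℝ) (j : ℕ) :
    w ^ j = (∑ i ∈ range (j + 1), (j.choose i : ℝ) * (Chebyshev.T ℝ (j - 2 * i)).eval w) / 2 ^ j := by
  have h := two_mul_pow_mul_eq_sum_choose (a := w) (f := fun z => (Chebyshev.T ℝ z).eval w)
    (fun z => by
      rw [Chebyshev.T_add_one]
      simp only [eval_sub, eval_mul, eval_X, eval_ofNat]
      ring) j 0
  simp only [Chebyshev.T_zero, eval_one, mul_one, zero_add] at h
  rw [← h, mul_pow]
  field_simp

/-- Hoeffding's inequality for the symmetric random walk of `j ≤ t` steps. -/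
theorem sum_choose_filter_le (j t d : ℕ) (hj : j ≤ t) (ht : 0 < t) :
    (∑ i ∈ range (j + 1) with ¬ ((j : ℤ) - 2 * (i : ℕ)).natAbs ≤ d, (j.choose i : ℝ)) / 2 ^ j
      ≤ 2 * Real.exp (-((d + 1 : ℝ) ^ 2 / (2 * t))) := by
  have ht' : (0 : ℝ) < t := by exact_mod_cast ht
  -- This `a` minimises the Chernoff exponent `a² t / 2 - a (d + 1)`.
  set a : ℝ := (d + 1) / t with ha
  have ha0 : 0 < a := by positivity
  have mgf : ∀ b : ℝ, (2 * Real.cosh b) ^ j =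
      ∑ i ∈ range (j + 1), (j.choose i : ℝ) * Real.exp (b * ((j : ℝ) - 2 * i)) := by
    intro b
    have h := two_mul_pow_mul_eq_sum_choose (a := Real.cosh b)
      (f := fun z : ℤ => Real.exp (b * z)) (fun z => by
        rw [Real.cosh_eq]
        push_cast
        rw [show b * ((z : ℝ) + 1) = b + b * z by ring,
          show b * ((z : ℝ) - 1) = -b + b * z by ring, Real.exp_add, Real.exp_add]
        ring) j 0
    simpa using h
  have key : ∑ i ∈ range (j + 1) with ¬ ((j : ℤ) - 2 * (i : ℕ)).natAbs ≤ d, (j.choose i : ℝ)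
      ≤ Real.exp (-(a * (d + 1))) * (2 * (2 * Real.cosh a) ^ j) := by
    have e : 2 * (2 * Real.cosh a) ^ j = ∑ i ∈ range (j + 1), (j.choose i : ℝ) *
        (Real.exp (a * ((j : ℝ) - 2 * i)) + Real.exp (-a * ((j : ℝ) - 2 * i))) := by
      simp only [mul_add, sum_add_distrib]
      rw [← mgf, ← mgf, Real.cosh_neg]
      ring
    rw [e, mul_sum]
    refine (sum_le_sum (f := fun i => (j.choose i : ℝ)) (g := fun i => Real.exp (-(a * (d + 1))) *
      ((j.choose i : ℝ) *
        (Real.exp (a * ((j : ℝ) - 2 * i)) + Real.exp (-a * ((j : ℝ) - 2 * i))))) ?_).trans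
      (sum_le_sum_of_subset_of_nonneg (filter_subset _ _) fun i _ _ => by positivity)
    intro i hi
    have hi2 : d + 1 ≤ ((j : ℤ) - 2 * (i : ℕ)).natAbs := by
      have := (mem_filter.1 hi).2
      omega
    have hz : (d + 1 : ℝ) ≤ |(j : ℝ) - 2 * i| := by
      have : ((d + 1 : ℕ) : ℤ) ≤ |(j : ℤ) - 2 * i| := by
        rw [Int.abs_eq_natAbs]
        exact_mod_cast hi2
      exact_mod_cast this
    have h1 : Real.exp (a * (d + 1)) ≤
        Real.exp (a * ((j : ℝ) - 2 * i)) + Real.exp (-a * ((j : ℝ) - 2 * i)) := by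
      rcases le_abs.1 hz with h | h
      · have := Real.exp_le_exp.2 (mul_le_mul_of_nonneg_left h ha0.le)
        linarith [Real.exp_pos (-a * ((j : ℝ) - 2 * i))]
      · have := Real.exp_le_exp.2 (mul_le_mul_of_nonneg_left h ha0.le)
        rw [mul_neg, ← neg_mul] at this
        linarith [Real.exp_pos (a * ((j : ℝ) - 2 * i))]
    have h2 : Real.exp (-(a * (d + 1))) * Real.exp (a * (d + 1)) = 1 := by
      rw [← Real.exp_add]
      simp
    calc (j.choose i : ℝ) = Real.exp (-(a * (d + 1))) * ((j.choose i : ℝ) *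
            Real.exp (a * (d + 1))) := by linear_combination -(j.choose i : ℝ) * h2
      _ ≤ _ := by gcongr
  have hc : Real.cosh a ^ j ≤ Real.exp (a ^ 2 / 2 * t) := by
    calc Real.cosh a ^ j ≤ Real.cosh a ^ t := pow_le_pow_right₀ (Real.one_le_cosh a) hj
      _ ≤ Real.exp (a ^ 2 / 2) ^ t := by
        gcongr
        exact Real.cosh_le_exp_half_sq a
      _ = _ := by rw [← Real.exp_nat_mul]; ring_nf
  rw [div_le_iff₀ (by positivity)]
  refine key.trans ?_
  rw [mul_pow]
  calc Real.exp (-(a * (d + 1))) * (2 * (2 ^ j * Real.cosh a ^ j))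
      ≤ Real.exp (-(a * (d + 1))) * (2 * (2 ^ j * Real.exp (a ^ 2 / 2 * t))) := by gcongr
    _ = 2 * (Real.exp (-(a * (d + 1))) * Real.exp (a ^ 2 / 2 * t)) * 2 ^ j := by ring
    _ = _ := by
      rw [← Real.exp_add]
      congr 3
      rw [ha]
      field_simp
      ring

/-! ### Odd Chebyshev primitives and their truncation. -/

/-- The odd primitive of the Chebyshev polynomial `T_{2z}`. -/
noncomputable def chebyshevPrimitive (z : ℤ) : ℝ[X] :=
  C (1 / 2 : ℝ) * (C (1 / (2 * z + 1) : ℝ) * Chebyshev.T ℝ (2 * z + 1)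
    - C (1 / (2 * z - 1) : ℝ) * Chebyshev.T ℝ (2 * z - 1))

theorem eval_chebyshevPrimitive (z : ℤ) (u : ℝ) :
    (chebyshevPrimitive z).eval u = 1 / 2 * (1 / (2 * z + 1) * (Chebyshev.T ℝ (2 * z + 1)).eval u
      - 1 / (2 * z - 1) * (Chebyshev.T ℝ (2 * z - 1)).eval u) := by
  simp [chebyshevPrimitive]

theorem natDegree_chebyshevPrimitive_le (z : ℤ) :
    (chebyshevPrimitive z).natDegree ≤ 2 * z.natAbs + 1 := by
  refine (natDegree_C_mul_le _ _).trans ((natDegree_sub_le _ _).trans (max_le ?_ ?_)) <;>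
  · refine (natDegree_C_mul_le _ _).trans ?_
    rw [Chebyshev.natDegree_T]
    omega

theorem eval_neg_chebyshevPrimitive (z : ℤ) (u : ℝ) :
    (chebyshevPrimitive z).eval (-u) = -(chebyshevPrimitive z).eval u := by
  have h1 : Int.negOnePow (2 * z + 1) = -1 := Int.negOnePow_odd _ ⟨z, rfl⟩
  have h2 : Int.negOnePow (2 * z - 1) = -1 := Int.negOnePow_odd _ ⟨z - 1, by ring⟩
  rw [eval_chebyshevPrimitive, eval_chebyshevPrimitive, Chebyshev.T_eval_neg, Chebyshev.T_eval_neg,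
    h1, h2]
  push_cast
  ring

/-- From `T_m' = m U_{m-1}` and `U_{2z} - U_{2z-2} = 2 T_{2z}`. -/
theorem derivative_chebyshevPrimitive (z : ℤ) :
    derivative (chebyshevPrimitive z) = Chebyshev.T ℝ (2 * z) := by
  have e1 : (2 * z + 1 : ℝ) ≠ 0 := by
    have : (2 * z + 1 : ℤ) ≠ 0 := by omega
    exact_mod_cast this
  have e2 : (2 * z - 1 : ℝ) ≠ 0 := by
    have : (2 * z - 1 : ℤ) ≠ 0 := by omega
    exact_mod_cast this
  have h := Chebyshev.two_mul_T_eq_U_sub_U ℝ (2 * z - 2)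
  rw [chebyshevPrimitive, derivative_C_mul, derivative_sub, derivative_C_mul, derivative_C_mul,
    Chebyshev.T_derivative_eq_U, Chebyshev.T_derivative_eq_U]
  refine Polynomial.funext fun x => ?_
  have hx := congrArg (eval x) h
  simp only [sub_add_cancel, eval_mul, eval_sub, eval_ofNat] at hx
  simp only [eval_mul, eval_sub, eval_C, eval_intCast, add_sub_cancel_right]
  rw [show 2 * z - 1 - 1 = 2 * z - 2 by ring]
  push_cast
  field_simp
  linarith

/-- Because `2v² - 1 = T_2(v)`, the integrand is `T_{2z}(v)`; oddness kills the constant of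
integration. -/
theorem integral_chebyshev_eval (z : ℤ) (u : ℝ) :
    ∫ v in (0 : ℝ)..u, (Chebyshev.T ℝ z).eval (2 * v ^ 2 - 1) = (chebyshevPrimitive z).eval u := by
  have h0 : (chebyshevPrimitive z).eval 0 = 0 := by
    have := eval_neg_chebyshevPrimitive z 0
    rw [neg_zero] at this
    linarith
  have hT : ∀ v : ℝ, (Chebyshev.T ℝ z).eval (2 * v ^ 2 - 1) = (Chebyshev.T ℝ (2 * z)).eval v := by
    intro v
    rw [mul_comm 2 z, Chebyshev.T_mul, eval_comp, Chebyshev.T_two]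
    simp
  simp only [hT]
  rw [intervalIntegral.integral_eq_sub_of_hasDerivAt (f := fun v => (chebyshevPrimitive z).eval v),
    h0, sub_zero]
  · intro v _
    rw [← derivative_chebyshevPrimitive]
    exact Polynomial.hasDerivAt _ _
  · exact (Polynomial.continuous _).intervalIntegrable _ _

/-- For `z ≠ 0` the two odd denominators are at least `1` and `3` in absolute value, in some order:
`(1 + 1/3) / 2 = 2/3`. -/
theorem abs_eval_chebyshevPrimitive_le {z : ℤ} (hz : z ≠ 0) {u : ℝ} (hu : |u| ≤ 1) :
    |(chebyshevPrimitive z).eval u| ≤ 2 / 3 := by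
  have hp := Chebyshev.abs_eval_T_real_le_one (2 * z + 1) hu
  have hm := Chebyshev.abs_eval_T_real_le_one (2 * z - 1) hu
  have e : |1 / (2 * (z : ℝ) + 1)| + |1 / (2 * (z : ℝ) - 1)| ≤ 4 / 3 := by
    rcases lt_or_gt_of_ne hz with h | h
    · have h' : (z : ℝ) ≤ -1 := by exact_mod_cast (by omega : z ≤ -1)
      have a1 : (1 : ℝ) / |2 * (z : ℝ) + 1| ≤ 1 / 1 :=
        one_div_le_one_div_of_le one_pos (by rw [abs_of_neg (by linarith)]; linarith)
      have a2 : (1 : ℝ) / |2 * (z : ℝ) - 1| ≤ 1 / 3 :=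
        one_div_le_one_div_of_le (by norm_num) (by rw [abs_of_neg (by linarith)]; linarith)
      rw [abs_div, abs_div, abs_one]
      linarith
    · have h' : (1 : ℝ) ≤ z := by exact_mod_cast (by omega : 1 ≤ z)
      have a1 : (1 : ℝ) / |2 * (z : ℝ) + 1| ≤ 1 / 3 :=
        one_div_le_one_div_of_le (by norm_num) (by rw [abs_of_pos (by linarith)]; linarith)
      have a2 : (1 : ℝ) / |2 * (z : ℝ) - 1| ≤ 1 / 1 :=
        one_div_le_one_div_of_le one_pos (by rw [abs_of_pos (by linarith)]; linarith)
      rw [abs_div, abs_div, abs_one]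
      linarith
  rw [eval_chebyshevPrimitive, abs_mul, abs_of_pos (by norm_num : (0 : ℝ) < 1 / 2)]
  have := abs_sub (1 / (2 * (z : ℝ) + 1) * (Chebyshev.T ℝ (2 * z + 1)).eval u)
    (1 / (2 * (z : ℝ) - 1) * (Chebyshev.T ℝ (2 * z - 1)).eval u)
  rw [abs_mul, abs_mul] at this
  have b1 := mul_le_mul_of_nonneg_left hp (abs_nonneg (1 / (2 * (z : ℝ) + 1)))
  have b2 := mul_le_mul_of_nonneg_left hm (abs_nonneg (1 / (2 * (z : ℝ) - 1)))
  linarith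

/-- The integral of `(2v² - 1)^j` from `0`, with the Chebyshev terms of index above `d` dropped. -/
noncomputable def truncatedPowPrimitive (d j : ℕ) : ℝ[X] :=
  C (1 / 2 ^ j : ℝ) * ∑ i ∈ range (j + 1) with ((j : ℤ) - 2 * (i : ℕ)).natAbs ≤ d,
    C (j.choose i : ℝ) * chebyshevPrimitive (j - 2 * i)

theorem natDegree_truncatedPowPrimitive_le (d j : ℕ) :
    (truncatedPowPrimitive d j).natDegree ≤ 2 * d + 1 := by
  refine (natDegree_C_mul_le _ _).trans (natDegree_sum_le_of_forall_le _ _ fun i hi => ?_)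
  refine (natDegree_C_mul_le _ _).trans ((natDegree_chebyshevPrimitive_le _).trans ?_)
  have := (mem_filter.1 hi).2
  omega

theorem eval_neg_truncatedPowPrimitive (d j : ℕ) (u : ℝ) :
    (truncatedPowPrimitive d j).eval (-u) = -(truncatedPowPrimitive d j).eval u := by
  simp only [truncatedPowPrimitive, eval_mul, eval_C, eval_finsetSum, eval_neg_chebyshevPrimitive,
    mul_neg, sum_neg_distrib]

theorem abs_integral_pow_sub_truncatedPowPrimitive_le {d j t : ℕ} (hj : j ≤ t) (ht : 0 < t)
    {u : ℝ} (hu : |u| ≤ 1) :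
    |(∫ v in (0 : ℝ)..u, (2 * v ^ 2 - 1) ^ j) - (truncatedPowPrimitive d j).eval u|
      ≤ 4 / 3 * Real.exp (-((d + 1 : ℝ) ^ 2 / (2 * t))) := by
  have hI : ∫ v in (0 : ℝ)..u, (2 * v ^ 2 - 1) ^ j =
      (∑ i ∈ range (j + 1), (j.choose i : ℝ) * (chebyshevPrimitive (j - 2 * i)).eval u) / 2 ^ j := by
    simp only [pow_eq_sum_choose_chebyshev (_ - 1)]
    rw [intervalIntegral.integral_div, intervalIntegral.integral_finsetSum]
    · simp only [intervalIntegral.integral_const_mul, integral_chebyshev_eval]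
    · intro i _
      refine Continuous.intervalIntegrable ?_ _ _
      exact continuous_const.mul ((Polynomial.continuous _).comp (by fun_prop))
  have hd : (∫ v in (0 : ℝ)..u, (2 * v ^ 2 - 1) ^ j) - (truncatedPowPrimitive d j).eval u =
      (∑ i ∈ range (j + 1) with ¬ ((j : ℤ) - 2 * (i : ℕ)).natAbs ≤ d,
        (j.choose i : ℝ) * (chebyshevPrimitive (j - 2 * i)).eval u) / 2 ^ j := by
    rw [hI, ← sum_filter_add_sum_filter_not (range (j + 1))
      (fun i : ℕ => ((j : ℤ) - 2 * (i : ℕ)).natAbs ≤ d)]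
    simp only [truncatedPowPrimitive, eval_mul, eval_C, eval_finsetSum]
    ring
  have hs : |∑ i ∈ range (j + 1) with ¬ ((j : ℤ) - 2 * (i : ℕ)).natAbs ≤ d,
        (j.choose i : ℝ) * (chebyshevPrimitive (j - 2 * i)).eval u| ≤
      (∑ i ∈ range (j + 1) with ¬ ((j : ℤ) - 2 * (i : ℕ)).natAbs ≤ d, (j.choose i : ℝ)) * (2 / 3) := by
    rw [sum_mul]
    refine (abs_sum_le_sum_abs _ _).trans (sum_le_sum fun i hi => ?_)
    rw [abs_mul, Nat.abs_cast]
    -- Dropped indices exceed `d ≥ 0` in absolute value, so they are nonzero.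
    refine mul_le_mul_of_nonneg_left (abs_eval_chebyshevPrimitive_le ?_ hu) (Nat.cast_nonneg _)
    have := (mem_filter.1 hi).2
    omega
  rw [hd, abs_div, abs_of_pos (by positivity : (0 : ℝ) < 2 ^ j)]
  refine (div_le_div_of_nonneg_right hs (by positivity)).trans ?_
  have := sum_choose_filter_le j t d hj ht
  rw [mul_div_right_comm]
  linarith

/-! ### Gaussian tail and Taylor remainder. -/

/-- The Gaussian tail bound. -/
theorem abs_half_gaussian_sub_integral_le {b u : ℝ} (hb : 0 < b) (hu : 0 < u) :
    |Real.sqrt (Real.pi / b) / 2 - ∫ v in (0 : ℝ)..u, Real.exp (-b * v ^ 2)|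
      ≤ Real.exp (-b * u ^ 2) / (2 * b * u) := by
  have hint := integrable_exp_neg_mul_sq hb
  have hsplit := intervalIntegral.integral_interval_add_Ioi (a := 0) (b := u)
    hint.integrableOn hint.integrableOn
  rw [integral_gaussian_Ioi] at hsplit
  -- On `v ≥ u` the factor `v / u ≥ 1` makes the integrand an exact derivative.
  have hderiv : ∀ v ∈ Set.Ici u, HasDerivAt (fun v => -(Real.exp (-b * v ^ 2) / (2 * b * u)))
      (v / u * Real.exp (-b * v ^ 2)) v := by
    intro v _
    have h := ((((hasDerivAt_pow 2 v).const_mul (-b)).exp).div_const (2 * b * u)).neg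
    refine h.congr_deriv ?_
    field_simp
    norm_num
    ring
  have hpos : ∀ v ∈ Set.Ioi u, 0 ≤ v / u * Real.exp (-b * v ^ 2) := fun v hv => by
    have : 0 < v := hu.trans hv
    positivity
  have hlim : Filter.Tendsto (fun v => -(Real.exp (-b * v ^ 2) / (2 * b * u))) Filter.atTop
      (nhds 0) := by
    have h1 : Filter.Tendsto (fun v : ℝ => b * v ^ 2) Filter.atTop Filter.atTop :=
      (Filter.tendsto_pow_atTop two_ne_zero).const_mul_atTop hb
    have h2 := ((Real.tendsto_exp_neg_atTop_nhds_zero.comp h1).div_const (2 * b * u)).neg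
    simpa [Function.comp_def] using h2
  have hI := MeasureTheory.integral_Ioi_of_hasDerivAt_of_nonneg' hderiv hpos hlim
  have hle : ∫ v in Set.Ioi u, Real.exp (-b * v ^ 2) ≤
      ∫ v in Set.Ioi u, v / u * Real.exp (-b * v ^ 2) := by
    refine MeasureTheory.setIntegral_mono_on hint.integrableOn
      (MeasureTheory.integrableOn_Ioi_deriv_of_nonneg' hderiv hpos hlim) measurableSet_Ioi ?_
    intro v hv
    exact le_mul_of_one_le_left (Real.exp_pos _).le ((one_le_div hu).2 (le_of_lt hv))
  have h0 : 0 ≤ ∫ v in Set.Ioi u, Real.exp (-b * v ^ 2) :=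
    MeasureTheory.setIntegral_nonneg measurableSet_Ioi fun v _ => (Real.exp_pos _).le
  rw [abs_of_nonneg (by linarith)]
  linarith

/-- Tail terms have `j ≥ t + 1 ≥ 2`, so `|w| ^ j ≤ w²`, and inserting `exp (2(j - t)) ≥ 1` sums the
tail to at most `w² exp (-2t) exp (e² λ)`. The factor `w²` is kept because its integral is at most
`7/15`; bounding it by `1` would overrun the error budget. -/
theorem abs_exp_sub_sum_le {lam w : ℝ} {t : ℕ} (hlam : 0 ≤ lam) (ht : 0 < t)
    (hlt : Real.exp 1 ^ 2 * lam ≤ t) (hw : |w| ≤ 1) :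
    |Real.exp (-lam * w) - ∑ j ∈ range (t + 1), (-lam * w) ^ j / (j.factorial : ℝ)|
      ≤ Real.exp (-t) * w ^ 2 := by
  have hasSum_exp : ∀ x : ℝ, HasSum (fun j : ℕ => x ^ j / (j.factorial : ℝ)) (Real.exp x) := by
    intro x
    rw [Real.exp_eq_exp_ℝ]
    exact NormedSpace.expSeries_div_hasSum_exp x
  have hfin := hasSum_sum_of_ne_finset_zero (s := range (t + 1)) (L := .unconditional ℕ)
    (f := fun j => if j ∈ range (t + 1) then (-lam * w) ^ j / (j.factorial : ℝ) else 0)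
    (fun j hj => if_neg hj)
  have hdiff := (hasSum_exp (-lam * w)).sub hfin
  have hg := (hasSum_exp (Real.exp 1 ^ 2 * lam)).mul_left (w ^ 2 * Real.exp (-(2 * t)))
  have hb := tsum_of_norm_bounded hg (f := fun j => (-lam * w) ^ j / (j.factorial : ℝ) -
    if j ∈ range (t + 1) then (-lam * w) ^ j / (j.factorial : ℝ) else 0) (fun j => by
      by_cases hj : j ∈ range (t + 1)
      · rw [if_pos hj, sub_self, norm_zero]
        positivity
      · rw [if_neg hj, sub_zero, Real.norm_eq_abs, abs_div, abs_pow, abs_mul, abs_neg,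
          abs_of_nonneg hlam, mul_pow, Nat.abs_cast]
        have hj' : t + 1 ≤ j := by simpa using hj
        have h1 : |w| ^ j ≤ w ^ 2 := by
          rw [← sq_abs w]
          exact pow_le_pow_of_le_one (abs_nonneg _) hw (by omega)
        have h2 : 1 ≤ Real.exp (-(2 * t)) * (Real.exp 1 ^ 2) ^ j := by
          rw [← pow_mul, ← Real.exp_nat_mul, ← Real.exp_add]
          refine Real.one_le_exp ?_
          have : (t : ℝ) + 1 ≤ j := by exact_mod_cast hj'
          push_cast
          linarith
        rw [mul_pow, ← mul_div_assoc]
        refine div_le_div_of_nonneg_right ?_ (Nat.cast_nonneg _)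
        calc lam ^ j * |w| ^ j ≤ lam ^ j * w ^ 2 := by gcongr
          _ ≤ (lam ^ j * w ^ 2) * (Real.exp (-(2 * t)) * (Real.exp 1 ^ 2) ^ j) :=
            le_mul_of_one_le_right (by positivity) h2
          _ = _ := by ring)
  rw [hdiff.tsum_eq, Real.norm_eq_abs] at hb
  have hs : ∑ j ∈ range (t + 1), (if j ∈ range (t + 1) then (-lam * w) ^ j / (j.factorial : ℝ)
      else 0) = ∑ j ∈ range (t + 1), (-lam * w) ^ j / (j.factorial : ℝ) :=
    sum_congr rfl fun j hj => if_pos hj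
  rw [hs] at hb
  refine hb.trans ?_
  calc w ^ 2 * Real.exp (-(2 * t)) * Real.exp (Real.exp 1 ^ 2 * lam)
      ≤ w ^ 2 * Real.exp (-(2 * t)) * Real.exp t := by gcongr
    _ = w ^ 2 * (Real.exp (-(2 * t)) * Real.exp t) := by ring
    _ = _ := by
      rw [← Real.exp_add, mul_comm]
      congr 2
      ring

theorem abs_integral_two_mul_sq_sub_one_sq_le {u : ℝ} (hu : |u| ≤ 1) :
    |∫ v in (0 : ℝ)..u, (2 * v ^ 2 - 1) ^ 2| ≤ 7 / 15 := by
  have hI : ∫ v in (0 : ℝ)..u, (2 * v ^ 2 - 1) ^ 2 = u * (4 / 5 * u ^ 4 - 4 / 3 * u ^ 2 + 1) := by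
    rw [intervalIntegral.integral_eq_sub_of_hasDerivAt
      (f := fun v : ℝ => 4 / 5 * v ^ 5 - 4 / 3 * v ^ 3 + v)]
    · ring
    · intro v _
      have := (((hasDerivAt_pow 5 v).const_mul (4 / 5)).sub
        ((hasDerivAt_pow 3 v).const_mul (4 / 3))).add (hasDerivAt_id v)
      refine this.congr_deriv ?_
      norm_num
      ring
    · exact Continuous.intervalIntegrable (by fun_prop) _ _
  have hq : 0 ≤ 4 / 5 * u ^ 4 - 4 / 3 * u ^ 2 + 1 := by nlinarith [sq_nonneg (u ^ 2 - 5 / 6)]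
  rw [hI, abs_mul, abs_of_nonneg hq, ← sq_abs u, show u ^ 4 = |u| ^ 4 by
    rw [show (4 : ℕ) = 2 * 2 by rfl, pow_mul, pow_mul, sq_abs]]
  have ha := abs_nonneg u
  generalize |u| = a at *
  -- This quartic is the cofactor of `1 - a` in `7/15 - a (4/5 a⁴ - 4/3 a² + 1)`.
  have : 0 ≤ 4 / 5 * (a ^ 4 + a ^ 3) - 8 / 15 * (a ^ 2 + a) + 7 / 15 := by
    nlinarith [sq_nonneg (a ^ 2 - 1 / 4), sq_nonneg (a - 1 / 2), mul_nonneg ha (sq_nonneg (a - 1 / 2))]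
  nlinarith [mul_nonneg (sub_nonneg.2 hu) this]

/-! ### Polynomial approximation of the Gaussian primitive. -/

/-- An odd polynomial approximation of the primitive of `exp (-2 λ v²)`. -/
noncomputable def gaussianPrimitive (lam : ℝ) (t d : ℕ) : ℝ[X] :=
  ∑ j ∈ range (t + 1),
    C (Real.exp (-lam) * ((-lam) ^ j / (j.factorial : ℝ))) * truncatedPowPrimitive d j

theorem natDegree_gaussianPrimitive_le (lam : ℝ) (t d : ℕ) :
    (gaussianPrimitive lam t d).natDegree ≤ 2 * d + 1 :=
  natDegree_sum_le_of_forall_le _ _ fun _ _ =>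
    (natDegree_C_mul_le _ _).trans (natDegree_truncatedPowPrimitive_le _ _)

theorem eval_neg_gaussianPrimitive (lam : ℝ) (t d : ℕ) (u : ℝ) :
    (gaussianPrimitive lam t d).eval (-u) = -(gaussianPrimitive lam t d).eval u := by
  simp only [gaussianPrimitive, eval_mul, eval_C, eval_finsetSum, eval_neg_truncatedPowPrimitive,
    mul_neg, sum_neg_distrib]

theorem abs_integral_gaussian_sub_gaussianPrimitive_le {lam : ℝ} {t : ℕ} (d : ℕ) (hlam : 0 ≤ lam)
    (ht : 0 < t) (hlt : Real.exp 1 ^ 2 * lam ≤ t) {u : ℝ} (hu : |u| ≤ 1) :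
    |(∫ v in (0 : ℝ)..u, Real.exp (-(2 * lam) * v ^ 2)) - (gaussianPrimitive lam t d).eval u|
      ≤ 7 / 15 * Real.exp (-t) + 4 / 3 * Real.exp (-((d + 1 : ℝ) ^ 2 / (2 * t))) := by
  set c : ℕ → ℝ := fun j => Real.exp (-lam) * ((-lam) ^ j / (j.factorial : ℝ)) with hc
  have hexp1 : Real.exp (-lam) ≤ 1 := Real.exp_le_one_iff.2 (by linarith)
  have hcont : ∀ j : ℕ, Continuous fun v : ℝ => c j * (2 * v ^ 2 - 1) ^ j := fun j => by fun_prop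
  have hcs : Continuous fun v : ℝ => ∑ j ∈ range (t + 1), c j * (2 * v ^ 2 - 1) ^ j :=
    continuous_finsetSum _ fun j _ => hcont j
  have hsum : ∫ v in (0 : ℝ)..u, ∑ j ∈ range (t + 1), c j * (2 * v ^ 2 - 1) ^ j =
      ∑ j ∈ range (t + 1), c j * ∫ v in (0 : ℝ)..u, (2 * v ^ 2 - 1) ^ j := by
    rw [intervalIntegral.integral_finsetSum fun j _ => (hcont j).intervalIntegrable _ _]
    simp only [intervalIntegral.integral_const_mul]
  have hTaylor : |(∫ v in (0 : ℝ)..u, Real.exp (-(2 * lam) * v ^ 2)) -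
      ∫ v in (0 : ℝ)..u, ∑ j ∈ range (t + 1), c j * (2 * v ^ 2 - 1) ^ j| ≤
      7 / 15 * Real.exp (-t) := by
    rw [← intervalIntegral.integral_sub (Continuous.intervalIntegrable (by fun_prop) _ _)
      (hcs.intervalIntegrable _ _)]
    have hb : ‖∫ v in (0 : ℝ)..u, (Real.exp (-(2 * lam) * v ^ 2) -
        ∑ j ∈ range (t + 1), c j * (2 * v ^ 2 - 1) ^ j)‖ ≤
        |∫ v in (0 : ℝ)..u, Real.exp (-t) * (2 * v ^ 2 - 1) ^ 2| := by
      refine intervalIntegral.norm_integral_le_abs_of_norm_le ?_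
        (Continuous.intervalIntegrable (by fun_prop) _ _)
      refine (MeasureTheory.ae_restrict_mem measurableSet_uIoc).mono fun v hv => ?_
      have hv1 : v ^ 2 ≤ 1 := by
        rw [sq_le_one_iff_abs_le_one]
        rcases Set.mem_uIoc.1 hv with h | h <;> rw [abs_le] at hu ⊢ <;>
          constructor <;> linarith [h.1, h.2]
      have hw : |2 * v ^ 2 - 1| ≤ 1 := by
        rw [abs_le]
        constructor <;> nlinarith [sq_nonneg v]
      have h := abs_exp_sub_sum_le hlam ht hlt hw
      have e : Real.exp (-(2 * lam) * v ^ 2) - ∑ j ∈ range (t + 1), c j * (2 * v ^ 2 - 1) ^ j =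
          Real.exp (-lam) * (Real.exp (-lam * (2 * v ^ 2 - 1)) -
            ∑ j ∈ range (t + 1), (-lam * (2 * v ^ 2 - 1)) ^ j / (j.factorial : ℝ)) := by
        rw [mul_sub, ← Real.exp_add, mul_sum]
        congr 1
        · congr 1
          ring
        · refine sum_congr rfl fun j _ => ?_
          rw [hc, mul_pow]
          ring
      rw [e, Real.norm_eq_abs, abs_mul, abs_of_pos (Real.exp_pos _)]
      exact (mul_le_of_le_one_left (abs_nonneg _) hexp1).trans h
    rw [Real.norm_eq_abs] at hb
    refine hb.trans ?_
    rw [intervalIntegral.integral_const_mul, abs_mul, abs_of_pos (Real.exp_pos _), mul_comm]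
    exact mul_le_mul_of_nonneg_right (abs_integral_two_mul_sq_sub_one_sq_le hu) (Real.exp_pos _).le
  have hCheb : |(∫ v in (0 : ℝ)..u, ∑ j ∈ range (t + 1), c j * (2 * v ^ 2 - 1) ^ j) -
      (gaussianPrimitive lam t d).eval u| ≤
      4 / 3 * Real.exp (-((d + 1 : ℝ) ^ 2 / (2 * t))) := by
    rw [hsum]
    simp only [gaussianPrimitive, eval_finsetSum, eval_mul, eval_C]
    rw [← sum_sub_distrib]
    -- The weights `exp (-λ) λ ^ j / j!` are Poisson, so truncation errors are averaged, not
    -- accumulated.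
    have hcsum : ∑ j ∈ range (t + 1), |c j| ≤ 1 := by
      have : ∀ j, |c j| = Real.exp (-lam) * (lam ^ j / (j.factorial : ℝ)) := fun j => by
        rw [hc, abs_mul, abs_of_pos (Real.exp_pos _), abs_div, abs_pow, abs_neg,
          abs_of_nonneg hlam, Nat.abs_cast]
      simp only [this]
      rw [← mul_sum]
      calc _ ≤ Real.exp (-lam) * Real.exp lam := by
            gcongr
            exact Real.sum_le_exp_of_nonneg hlam _
        _ = 1 := by rw [← Real.exp_add]; simp
    calc _ ≤ ∑ j ∈ range (t + 1), |c j| * (4 / 3 * Real.exp (-((d + 1 : ℝ) ^ 2 / (2 * t)))) := by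
          refine (abs_sum_le_sum_abs _ _).trans (sum_le_sum fun j hj => ?_)
          change |c j * _ - c j * _| ≤ _
          rw [← mul_sub, abs_mul]
          exact mul_le_mul_of_nonneg_left (abs_integral_pow_sub_truncatedPowPrimitive_le
            (Nat.lt_succ_iff.1 (mem_range.1 hj)) ht hu) (abs_nonneg _)
      _ ≤ _ := by
        rw [← sum_mul]
        exact mul_le_of_le_one_left (by positivity) hcsum
  exact (abs_sub_le _ _ _).trans (add_le_add hTaylor hCheb)

/-! ### Making the degree exact. -/

theorem exists_natDegree_add_C_mul_eq {p : ℝ[X]} {m : ℕ} (hp : p.natDegree ≤ m) (s : ℝ) {r : ℝ}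
    (hr : 0 < r) : ∃ η : ℝ, |η| ≤ r ∧ (p + C η * (X - C s) ^ m).natDegree = m := by
  have hm : ((X - C s : ℝ[X]) ^ m).coeff m = 1 := by
    have h := ((monic_X_sub_C s).pow m).coeff_natDegree
    rwa [natDegree_pow, natDegree_X_sub_C, mul_one] at h
  have key : ∀ η : ℝ, p.coeff m + η ≠ 0 → (p + C η * (X - C s) ^ m).natDegree = m := by
    intro η h
    refine le_antisymm (natDegree_add_le_of_degree_le hp ((natDegree_C_mul_le _ _).trans ?_))
      (le_natDegree_of_ne_zero ?_)
    · rw [natDegree_pow, natDegree_X_sub_C, mul_one]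
    · rwa [coeff_add, coeff_C_mul, hm, mul_one]
  -- Only one value of `η` cancels the coefficient, so `r` or `r / 2` works.
  by_cases h : p.coeff m + r = 0
  · refine ⟨r / 2, by rw [abs_of_pos (by positivity)]; linarith, key _ fun h' => ?_⟩
    linarith
  · exact ⟨r, (abs_of_pos hr).le, key _ h⟩

/-- Strict approximation by a polynomial of degree at most `m`, odd about `s`, can be turned into
approximation by one of degree exactly `m`. -/
theorem exists_natDegree_eq_of_approx {s ε c : ℝ} {m : ℕ} (hm : Odd m) {f : ℝ → ℝ} {S : Set ℝ}
    (hS : ∀ x ∈ S, |x - s| ≤ 2) (hc : c < ε) {p : ℝ[X]} (hp : p.natDegree ≤ m)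
    (hodd : ∀ y, p.eval (s - y) = -p.eval (s + y)) (happ : ∀ x ∈ S, |p.eval x - f x| ≤ c) :
    ∃ q : ℝ[X], q.natDegree = m ∧ (∀ y, q.eval (s - y) = -q.eval (s + y)) ∧
      ∀ x ∈ S, |q.eval x - f x| ≤ ε := by
  obtain ⟨η, hη, hq⟩ := exists_natDegree_add_C_mul_eq hp s
    (r := (ε - c) / 2 ^ m) (div_pos (sub_pos.2 hc) (by positivity))
  refine ⟨_, hq, fun y => ?_, fun x hx => ?_⟩
  · simp only [eval_add, eval_mul, eval_C, eval_pow, eval_sub, eval_X, hodd]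
    rw [show s - y - s = -(s + y - s) by ring, hm.neg_pow]
    ring
  · simp only [eval_add, eval_mul, eval_C, eval_pow, eval_sub, eval_X]
    have h1 : |η * (x - s) ^ m| ≤ ε - c := by
      rw [abs_mul, abs_pow]
      calc |η| * |x - s| ^ m ≤ (ε - c) / 2 ^ m * 2 ^ m :=
            mul_le_mul hη (pow_le_pow_left₀ (abs_nonneg _) (hS x hx) m) (by positivity)
              (div_nonneg (sub_pos.2 hc).le (by positivity))
        _ = _ := by field_simp
    calc _ = |(eval x p - f x) + η * (x - s) ^ m| := by congr 1; ring
      _ ≤ _ := (abs_add_le _ _).trans (by linarith [happ x hx])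

/-! ### Estimates for `k`, `T` and `n`. -/

theorem one_le_log_of_le {ε : ℝ} (hε : 0 < ε)
    (hε' : ε ≤ 2 * Real.sqrt (2 / (Real.exp 1 * Real.pi))) :
    1 ≤ Real.log (8 / (Real.pi * ε ^ 2)) := by
  have hpi := Real.pi_pos
  have he := Real.exp_pos 1
  have h2 : ε ^ 2 ≤ 8 / (Real.exp 1 * Real.pi) := by
    calc ε ^ 2 ≤ (2 * Real.sqrt (2 / (Real.exp 1 * Real.pi))) ^ 2 := by gcongr
      _ = _ := by
        rw [mul_pow, Real.sq_sqrt (by positivity)]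
        ring
  rw [Real.le_log_iff_exp_le (by positivity), le_div_iff₀ (by positivity)]
  rw [le_div_iff₀ (by positivity)] at h2
  linarith

theorem le_one_of_le_two_mul_sqrt {ε : ℝ} (hε : 0 < ε)
    (hε' : ε ≤ 2 * Real.sqrt (2 / (Real.exp 1 * Real.pi))) : ε ≤ 1 := by
  have h := (Real.le_log_iff_exp_le (by positivity)).1 (one_le_log_of_le hε hε')
  rw [le_div_iff₀ (by positivity)] at h
  have h8 : 8 ≤ Real.exp 1 * Real.pi := by
    nlinarith [Real.exp_one_gt_d9, Real.pi_gt_d2]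
  by_contra hc
  push Not at hc
  nlinarith [mul_pos (Real.exp_pos 1) Real.pi_pos]

theorem signScale_pos {Δ ε : ℝ} (hΔ : 0 < Δ) (hL : 1 ≤ Real.log (8 / (Real.pi * ε ^ 2))) :
    0 < signScale Δ ε := by
  have : 0 < Real.log (8 / (Real.pi * ε ^ 2)) := by linarith
  unfold signScale
  positivity

theorem signScale_sq {Δ ε : ℝ} (hL : 1 ≤ Real.log (8 / (Real.pi * ε ^ 2))) :
    signScale Δ ε ^ 2 = 2 / Δ ^ 2 * Real.log (8 / (Real.pi * ε ^ 2)) := by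
  rw [signScale, mul_pow, div_pow, Real.sq_sqrt (by norm_num), Real.sq_sqrt (by linarith)]

theorem signTermQuad_eq {Δ ε : ℝ} (hL : 1 ≤ Real.log (8 / (Real.pi * ε ^ 2))) :
    signTermQuad Δ ε = Real.exp 1 ^ 2 * (2 * signScale Δ ε ^ 2) := by
  rw [signScale_sq hL, signTermQuad]
  ring

theorem exp_neg_half_log_sq {ε : ℝ} (hε : 0 < ε) :
    Real.exp (-(Real.log (8 / (Real.pi * ε ^ 2)) / 2)) ^ 2 = Real.pi * ε ^ 2 / 8 := by
  rw [← Real.exp_nat_mul, show ((2 : ℕ) : ℝ) * -(Real.log (8 / (Real.pi * ε ^ 2)) / 2) =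
    -Real.log (8 / (Real.pi * ε ^ 2)) by push_cast; ring, Real.exp_neg,
    Real.exp_log (by positivity), inv_div]

/-- With `L = ln (8 / (π ε²))`, the left side is at most `ln (32k/3) + L/2`. For `Δ ≤ 2` one has
`L/2 ≤ k²`, so `ln y ≤ y - 1` leaves `32k/3 - 1 + k² ≤ 14.6 k²`, true for `k ≥ 7/10`; and `k² ≥ L/2
≥ 1/2`. -/
theorem signTermLog_le_signTermQuad {Δ ε : ℝ} (hΔ : 0 < Δ) (hε : 0 < ε)
    (hL : 1 ≤ Real.log (8 / (Real.pi * ε ^ 2))) (hΔ2 : Δ ≤ 2) :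
    signTermLog Δ ε ≤ signTermQuad Δ ε := by
  set L := Real.log (8 / (Real.pi * ε ^ 2)) with hLdef
  have hk := signScale_pos hΔ hL
  have hk2 := signScale_sq (Δ := Δ) hL
  have hX2 := exp_neg_half_log_sq hε
  rw [← hLdef] at hX2 hk2
  set k := signScale Δ ε
  set x := Real.exp (-(L / 2)) with hx
  have hx0 : 0 < x := Real.exp_pos _
  have hsp := Real.sqrt_pos.2 Real.pi_pos
  have hxe : x ≤ Real.sqrt Real.pi * ε := by
    refine le_of_sq_le_sq ?_ (by positivity)
    rw [hX2, mul_pow, Real.sq_sqrt Real.pi_pos.le]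
    nlinarith [mul_pos Real.pi_pos (pow_pos hε 2)]
  have hkL : L ≤ 2 * k ^ 2 := by
    rw [hk2]
    have : 1 ≤ 4 / Δ ^ 2 := by
      rw [le_div_iff₀ (by positivity)]
      nlinarith
    calc L ≤ 4 / Δ ^ 2 * L := le_mul_of_one_le_left (by linarith) this
      _ = _ := by ring
  have hlog : signTermLog Δ ε ≤ Real.log (32 / 3 * k) + L / 2 := by
    have e : L / 2 = -Real.log x := by rw [hx, Real.log_exp, neg_neg]
    rw [e, ← sub_eq_add_neg, ← Real.log_div (by positivity) hx0.ne', signTermLog]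
    refine Real.log_le_log (by positivity) ?_
    calc 32 * k / (3 * Real.sqrt Real.pi * ε) = 32 / 3 * k / (Real.sqrt Real.pi * ε) := by
          field_simp
      _ ≤ _ := by gcongr
  have h1 := Real.log_le_sub_one_of_pos (show 0 < 32 / 3 * k by positivity)
  have he : 7.3 ≤ Real.exp 1 ^ 2 := by nlinarith [Real.exp_one_gt_d9]
  rw [signTermQuad_eq hL]
  change _ ≤ Real.exp 1 ^ 2 * (2 * k ^ 2)
  have h3 : 7.3 * (2 * k ^ 2) ≤ Real.exp 1 ^ 2 * (2 * k ^ 2) := by gcongr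
  have hk7 : 7 / 10 ≤ k := by nlinarith
  nlinarith [mul_nonneg (sub_nonneg.2 hk7) (sub_nonneg.2 hk7)]

theorem signTermQuad_pos {Δ ε : ℝ} (hΔ : 0 < Δ) (hL : 1 ≤ Real.log (8 / (Real.pi * ε ^ 2))) :
    0 < signTermQuad Δ ε := by
  have := signScale_pos hΔ hL
  rw [signTermQuad_eq hL]
  positivity

/-- The Chebyshev truncation error at the degree prescribed by `signDegree`. -/
theorem exp_neg_signDegree_le {Δ ε T : ℝ} (hΔ : 0 < Δ) (hΔ4 : Δ ≤ 4) (hε : 0 < ε) (hε1 : ε ≤ 1)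
    (hL : 1 ≤ Real.log (8 / (Real.pi * ε ^ 2))) (hT : 0 < T) :
    Real.exp (-((((signDegreeOf T Δ ε - 1) / 2 : ℕ) + 1 : ℝ) ^ 2 / (2 * (⌈T⌉₊ : ℝ)))) ≤
      3 * Real.sqrt Real.pi * ε / (64 * signScale Δ ε) := by
  have hk := signScale_pos hΔ hL
  have hk2 := signScale_sq (Δ := Δ) hL
  have ht : (0 : ℝ) < (⌈T⌉₊ : ℝ) := by exact_mod_cast Nat.ceil_pos.2 hT
  have hsp := Real.sqrt_pos.2 Real.pi_pos
  have hn := Nat.le_ceil (Real.sqrt (8 * (⌈T⌉₊ : ℝ) *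
      Real.log (64 * signScale Δ ε / (3 * Real.sqrt Real.pi * ε))) + 1)
  change _ ≤ ((signDegreeOf T Δ ε : ℕ) : ℝ) at hn
  set k := signScale Δ ε
  set n := signDegreeOf T Δ ε
  set A := Real.log (64 * k / (3 * Real.sqrt Real.pi * ε)) with hA
  -- Dropped indices start at `d + 1`, and `2 (d + 1) ≥ n` for either parity of `n`.
  have hd : (n : ℝ) ≤ 2 * (((n - 1) / 2 : ℕ) + 1) := by
    exact_mod_cast (by omega : n ≤ 2 * ((n - 1) / 2 + 1))
  set D : ℝ := ((n - 1) / 2 : ℕ) + 1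
  have hkl : 1 / 8 ≤ k ^ 2 := by
    rw [hk2]
    have : 1 / 8 ≤ 2 / Δ ^ 2 := by
      rw [div_le_div_iff₀ (by norm_num) (by positivity)]
      nlinarith
    exact this.trans (le_mul_of_one_le_right (by positivity) hL)
  have hkl' : 1 / 4 ≤ k := by nlinarith
  have hspi : Real.sqrt Real.pi ≤ 2 := by
    rw [Real.sqrt_le_left (by norm_num)]
    nlinarith [Real.pi_le_four]
  -- `Δ ≤ 4` gives `k ≥ 1/4`, so the radicand is nonnegative and the square root is genuine.
  have hA0 : 0 ≤ A := by
    refine Real.log_nonneg ?_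
    rw [one_le_div (by positivity)]
    have : Real.sqrt Real.pi * ε ≤ 2 * 1 := by gcongr
    linarith
  set R := Real.sqrt (8 * (⌈T⌉₊ : ℝ) * A) with hR
  have hR0 : 0 ≤ R := Real.sqrt_nonneg _
  have hR2 : R ^ 2 = 8 * (⌈T⌉₊ : ℝ) * A := Real.sq_sqrt (by positivity)
  have hAD : A ≤ D ^ 2 / (2 * (⌈T⌉₊ : ℝ)) := by
    rw [le_div_iff₀ (by positivity)]
    have : R ^ 2 ≤ (2 * D) ^ 2 := by
      gcongr
      linarith
    nlinarith
  calc _ ≤ Real.exp (-A) := Real.exp_le_exp.2 (neg_le_neg hAD)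
    _ = _ := by rw [hA, Real.exp_neg, Real.exp_log (by positivity), inv_div]

/-! ### Error budget and assembly. -/

/-- `erf` of scale `k` is within `ε / 2` of `1` at distance at least `Δ / 2` from its centre. -/
theorem abs_scaled_integral_sub_one_le {Δ ε u : ℝ} (hΔ : 0 < Δ) (hε : 0 < ε)
    (hL : 1 ≤ Real.log (8 / (Real.pi * ε ^ 2))) (hu : Δ / 4 ≤ u) :
    |4 * signScale Δ ε / Real.sqrt Real.pi *
      (∫ v in (0 : ℝ)..u, Real.exp (-(2 * (2 * signScale Δ ε ^ 2)) * v ^ 2)) - 1| ≤ ε / 2 := by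
  have hk := signScale_pos hΔ hL
  have hk2 := signScale_sq (Δ := Δ) hL
  have hX2 := exp_neg_half_log_sq hε
  set k := signScale Δ ε
  set L := Real.log (8 / (Real.pi * ε ^ 2))
  set x := Real.exp (-(L / 2)) with hx
  have hx0 : 0 < x := Real.exp_pos _
  have hu0 : 0 < u := by linarith
  have hsp := Real.sqrt_pos.2 Real.pi_pos
  have hsq := Real.sq_sqrt Real.pi_pos.le
  have htail := abs_half_gaussian_sub_integral_le (b := 2 * (2 * k ^ 2)) (by positivity) hu0
  have hg : Real.sqrt (Real.pi / (2 * (2 * k ^ 2))) / 2 = Real.sqrt Real.pi / (4 * k) := by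
    rw [show 2 * (2 * k ^ 2) = (2 * k) ^ 2 by ring, Real.sqrt_div Real.pi_pos.le,
      Real.sqrt_sq (by positivity)]
    field_simp
    norm_num
  rw [hg] at htail
  set I := ∫ v in (0 : ℝ)..u, Real.exp (-(2 * (2 * k ^ 2)) * v ^ 2)
  have hkΔ : (k * Δ) ^ 2 = 2 * L := by
    rw [mul_pow, hk2]
    field_simp
  have hexp : Real.exp (-(2 * (2 * k ^ 2)) * u ^ 2) ≤ x := by
    refine Real.exp_le_exp.2 ?_
    have h1 : (Δ / 4) ^ 2 ≤ u ^ 2 := by gcongr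
    have h2 : k ^ 2 * (Δ / 4) ^ 2 ≤ k ^ 2 * u ^ 2 := by gcongr
    nlinarith
  -- Squared, this is `2πε² ≤ 2πε² L`, that is `L ≥ 1`, which the upper bound on `ε` supplies.
  have hxk : 4 * x ≤ ε * Real.sqrt Real.pi * (k * Δ) := by
    refine le_of_sq_le_sq ?_ (by positivity)
    rw [mul_pow, mul_pow, mul_pow, hX2, hsq, hkΔ]
    nlinarith [mul_pos Real.pi_pos (pow_pos hε 2)]
  have e : 4 * k / Real.sqrt Real.pi * I - 1 =
      -(4 * k / Real.sqrt Real.pi * (Real.sqrt Real.pi / (4 * k) - I)) := by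
    field_simp
    ring
  rw [e, abs_neg, abs_mul, abs_of_pos (by positivity)]
  calc _ ≤ 4 * k / Real.sqrt Real.pi * (x / (2 * (2 * (2 * k ^ 2)) * (Δ / 4))) := by
        gcongr
        refine htail.trans ?_
        gcongr
    _ = 2 * x / (Real.sqrt Real.pi * (k * Δ)) := by
        field_simp
        norm_num
    _ ≤ _ := by
        rw [div_le_div_iff₀ (by positivity) (by norm_num)]
        linarith

theorem abs_scaled_gaussianPrimitive_sub_one_le {Δ ε T u : ℝ} (hΔ : 0 < Δ) (hΔ4 : Δ ≤ 4)
    (hε : 0 < ε) (hε1 : ε ≤ 1) (hL : 1 ≤ Real.log (8 / (Real.pi * ε ^ 2)))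
    (hTL : signTermLog Δ ε ≤ T) (hTQ : signTermQuad Δ ε ≤ T) (hu : Δ / 4 ≤ u) (hu1 : u ≤ 1) :
    |4 * signScale Δ ε / Real.sqrt Real.pi * (gaussianPrimitive (2 * signScale Δ ε ^ 2) ⌈T⌉₊
      ((signDegreeOf T Δ ε - 1) / 2)).eval u - 1| ≤ 37 / 40 * ε := by
  have hT : 0 < T := (signTermQuad_pos hΔ hL).trans_le hTQ
  have hk := signScale_pos hΔ hL
  have hsp := Real.sqrt_pos.2 Real.pi_pos
  have hCheb := exp_neg_signDegree_le hΔ hΔ4 hε hε1 hL hT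
  have herf := abs_scaled_integral_sub_one_le hΔ hε hL hu
  have htT := Nat.le_ceil T
  have happ := abs_integral_gaussian_sub_gaussianPrimitive_le (lam := 2 * signScale Δ ε ^ 2)
    (t := ⌈T⌉₊) ((signDegreeOf T Δ ε - 1) / 2) (by positivity) (Nat.ceil_pos.2 hT)
    (by rw [← signTermQuad_eq hL]; linarith)
    (u := u) (by rw [abs_le]; constructor <;> linarith)
  have hTay : Real.exp (-(⌈T⌉₊ : ℝ)) ≤ 3 * Real.sqrt Real.pi * ε / (32 * signScale Δ ε) := by
    calc _ ≤ Real.exp (-signTermLog Δ ε) := Real.exp_le_exp.2 (by linarith)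
      _ = _ := by rw [signTermLog, Real.exp_neg, Real.exp_log (by positivity), inv_div]
  set k := signScale Δ ε
  set G := (gaussianPrimitive (2 * k ^ 2) ⌈T⌉₊ ((signDegreeOf T Δ ε - 1) / 2)).eval u
  set I := ∫ v in (0 : ℝ)..u, Real.exp (-(2 * (2 * k ^ 2)) * v ^ 2)
  have hGI : |4 * k / Real.sqrt Real.pi * (I - G)| ≤ 17 / 40 * ε := by
    rw [abs_mul, abs_of_pos (by positivity)]
    calc _ ≤ 4 * k / Real.sqrt Real.pi * (7 / 15 * (3 * Real.sqrt Real.pi * ε / (32 * k)) +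
          4 / 3 * (3 * Real.sqrt Real.pi * ε / (64 * k))) := by
          gcongr
          exact happ.trans (by gcongr)
      _ = _ := by
        field_simp
        norm_num
  calc _ = |(4 * k / Real.sqrt Real.pi * I - 1) - 4 * k / Real.sqrt Real.pi * (I - G)| := by
        congr 1
        ring
    _ ≤ _ := (abs_sub _ _).trans (by linarith)

/-- Halving `x - s` keeps the argument in `[-1, 1]` and turns the gap `Δ/2` into `Δ/4`; oddness
transfers the bound to the left interval. -/
theorem exists_odd_sign_approx {s Δ ε : ℝ} (hs : s ∈ Set.Icc (-1 : ℝ) 1) (hΔ : 0 < Δ)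
    (hΔ4 : Δ ≤ 4) (hε : 0 < ε) (hε1 : ε ≤ 1) (hL : 1 ≤ Real.log (8 / (Real.pi * ε ^ 2))) :
    ∃ p : ℝ[X], p.natDegree ≤ 2 * ((signDegree Δ ε - 1) / 2) + 1 ∧
      (∀ y : ℝ, p.eval (s - y) = -p.eval (s + y)) ∧
      ∀ x ∈ Set.Icc (-1 : ℝ) (s - Δ / 2) ∪ Set.Icc (s + Δ / 2) 1,
        |p.eval x - Real.sign (x - s)| ≤ 37 / 40 * ε := by
  set T := max (signTermLog Δ ε) (signTermQuad Δ ε)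
  set G := gaussianPrimitive (2 * signScale Δ ε ^ 2) ⌈T⌉₊ ((signDegree Δ ε - 1) / 2)
  set c := 4 * signScale Δ ε / Real.sqrt Real.pi
  have hev : ∀ x, (C c * G.comp (C (1 / 2) * (X - C s))).eval x = c * G.eval ((x - s) / 2) := by
    intro x
    simp only [eval_mul, eval_C, eval_comp, eval_sub, eval_X]
    congr 2
    ring
  have hneg : ∀ u, G.eval (-u) = -G.eval u := eval_neg_gaussianPrimitive _ _ _
  have happ : ∀ u, Δ / 4 ≤ u → u ≤ 1 → |c * G.eval u - 1| ≤ 37 / 40 * ε := fun u h h' =>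
    abs_scaled_gaussianPrimitive_sub_one_le hΔ hΔ4 hε hε1 hL (le_max_left _ _) (le_max_right _ _)
      h h'
  refine ⟨C c * G.comp (C (1 / 2) * (X - C s)), ?_, fun y => ?_, fun x hx => ?_⟩
  · refine (natDegree_C_mul_le _ _).trans (natDegree_comp_le.trans ?_)
    have h1 : (C (1 / 2) * (X - C s) : ℝ[X]).natDegree ≤ 1 :=
      (natDegree_C_mul_le _ _).trans (natDegree_X_sub_C s).le
    exact (Nat.mul_le_mul (natDegree_gaussianPrimitive_le _ _ _) h1).trans (mul_one _).le
  · rw [hev, hev, show (s - y - s) / 2 = -((s + y - s) / 2) by ring, hneg]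
    ring
  · rw [hev]
    rcases hx with hx | hx
    · rw [Real.sign_of_neg (by linarith [hx.2])]
      have := happ (-((x - s) / 2)) (by linarith [hx.2]) (by linarith [hx.1, hs.2])
      rw [hneg, abs_sub_comm] at this
      convert this using 2
      ring
    · rw [Real.sign_of_pos (by linarith [hx.1])]
      exact happ _ (by linarith [hx.1]) (by linarith [hx.2, hs.1])

theorem theorem4 (s Δ ε : ℝ) (hs : s ∈ Set.Icc (-1 : ℝ) 1) (hΔ : 0 < Δ) (hε : 0 < ε)
    (hε' : ε ≤ 2 * Real.sqrt (2 / (Real.exp 1 * Real.pi))) :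
    (∃ p : Polynomial ℝ,
      (Odd (signDegree Δ ε) → p.natDegree = signDegree Δ ε) ∧
      (Even (signDegree Δ ε) → p.natDegree + 1 = signDegree Δ ε) ∧
      (∀ y : ℝ, p.eval (s - y) = -p.eval (s + y)) ∧
      (∀ x ∈ Set.Icc (-1 : ℝ) (s - Δ / 2) ∪ Set.Icc (s + Δ / 2) 1,
        |p.eval x - Real.sign (x - s)| ≤ ε)) ∧
    (Δ ≤ 2 →
      max (signTermLog Δ ε) (signTermQuad Δ ε) = signTermQuad Δ ε ∧
      signDegree Δ ε = signDegreeOf (signTermQuad Δ ε) Δ ε) := by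
  have hL := one_le_log_of_le hε hε'
  have hε1 := le_one_of_le_two_mul_sqrt hε hε'
  refine ⟨?_, fun hΔ2 => ?_⟩
  -- Positivity of `n` makes the truncated `n - 1` a true difference, so `2 ((n - 1) / 2) + 1` is
  -- `n` or `n - 1` by parity.
  · have hn : 0 < signDegree Δ ε := Nat.ceil_pos.2 (by positivity)
    obtain ⟨p, hdeg, hodd, happ⟩ : ∃ p : ℝ[X],
        p.natDegree = 2 * ((signDegree Δ ε - 1) / 2) + 1 ∧
        (∀ y : ℝ, p.eval (s - y) = -p.eval (s + y)) ∧
        ∀ x ∈ Set.Icc (-1 : ℝ) (s - Δ / 2) ∪ Set.Icc (s + Δ / 2) 1,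
          |p.eval x - Real.sign (x - s)| ≤ ε := by
      have hm : Odd (2 * ((signDegree Δ ε - 1) / 2) + 1) := ⟨_, rfl⟩
      have hS : ∀ x ∈ Set.Icc (-1 : ℝ) (s - Δ / 2) ∪ Set.Icc (s + Δ / 2) 1, |x - s| ≤ 2 := by
        rintro x (hx | hx) <;> rw [abs_le] <;> constructor <;>
          linarith [hx.1, hx.2, hs.1, hs.2]
      rcases le_or_gt Δ 4 with hΔ4 | hΔ4
      · obtain ⟨p, hdeg, hodd, happ⟩ := exists_odd_sign_approx hs hΔ hΔ4 hε hε1 hL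
        exact exists_natDegree_eq_of_approx hm hS (by linarith) hdeg hodd happ
      -- For `Δ > 4` both intervals are empty, so only degree and oddness matter.
      · refine exists_natDegree_eq_of_approx (p := 0) hm hS (half_lt_self hε) (by simp) (by simp)
          fun x hx => ?_
        rcases hx with hx | hx <;> linarith [hx.1, hx.2, hs.1, hs.2]
    refine ⟨p, fun h => ?_, fun h => ?_, hodd, happ⟩
    · obtain ⟨r, hr⟩ := h
      omega
    · obtain ⟨r, hr⟩ := h
      omega
  · have h := max_eq_right (signTermLog_le_signTermQuad hΔ hε hL hΔ2)
    exact ⟨h, by rw [signDegree, h]⟩
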